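/- Let $R$ be a nonzero commutative ring with identity and let $G$ be a torsion abelian group, written multiplicatively. Write $\mathfrak J(A)$ for the Jacobson radical of a commutative ring $A$. For a subgroup $N$ of $G$, let $I(R,N)$ be the augmentation ideal of the group ring $RN$, i.e. the kernel of the $R$-algebra homomorphism $RN\to R$ sending every element of $N$ to $1$, and let $\Phi(N)=I(R,N)RG$ be the ideal of the group ring $RG$ generated by it. For a prime $p$, let $G_p$ be the subgroup of all elements of $G$ whose order is a power of $p$, and let $\operatorname{supp} G$ be the set of primes $p$ with $G_p\neq 1$. Then the following conditions are equivalent: (1) $\mathfrak J(RG)=\Phi(N)$ for some subgroup $N\neq 1$ of $G$; (2) $\mathfrak J(R)=0$ and $\operatorname{char} R=p$ for some $p\in\operatorname{supp} G$. Moreover, if these conditions are satisfied, then $\mathfrak J(RG)=\Phi(G_p)$, where $p=\operatorname{char} R$. -/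

import Mathlib

namespace GroupRingIdeals

/-- The augmentation map `RG → R`, the `R`-algebra homomorphism sending every `g ∈ G` to `1`. -/
noncomputable def augmentation (R G : Type*) [CommRing R] [CommGroup G] :
    MonoidAlgebra R G →ₐ[R] R :=
  MonoidAlgebra.lift R R G (1 : G →* R)

/-- The augmentation ideal `I(R, G)` of the group ring `RG`. -/
noncomputable def augmentationIdeal (R G : Type*) [CommRing R] [CommGroup G] :
    Ideal (MonoidAlgebra R G) :=
  RingHom.ker (augmentation R G)

/-- `Φ(N) = I(R, N) RG`, the ideal of `RG` generated by the image of the augmentation ideal of `RN`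
under the inclusion `RN → RG`. -/
noncomputable def Phi (R : Type*) {G : Type*} [CommRing R] [CommGroup G] (N : Subgroup G) :
    Ideal (MonoidAlgebra R G) :=
  (augmentationIdeal R N).map (MonoidAlgebra.mapDomainAlgHom R R N.subtype)

/-- `supp G`, the set of primes `p` for which the `p`-primary component `G_p` of the abelian
group `G` is nontrivial. -/
def supp (G : Type*) [CommGroup G] : Set ℕ :=
  {p | p.Prime ∧ CommGroup.primaryComponent G p ≠ ⊥}

end GroupRingIdeals

namespace GroupRingIdeals

open MonoidAlgebra

variable {R G H : Type*} [CommRing R] [CommGroup G] [CommGroup H]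

/-! (2) ⇒ (1): in characteristic `p`, each `g - 1` with `g ∈ G_p` is nilpotent, so `Φ(G_p)` lies in
the radical. Conversely, `RG / Φ(G_p)` is `R[G/G_p]`, whose group has no `p`-torsion; its radical
vanishes by reduction to the fields `R/m` and Maschke's theorem.

(1) ⇒ (2): `RG` is integral over `R`, so `𝔍(R) ⊆ 𝔍(RG) = Φ(N)`, and the augmentation, which kills
`Φ(N)` and fixes scalars, gives `𝔍(R) = 0`. If `g ∈ N` has prime order `p`, then `g - 1 ∈ 𝔍(RG)`
forces `p ∈ 𝔍(R) = 0` (`natCast_mem_jacobson`). -/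

lemma augmentation_single (g : G) (r : R) : augmentation R G (single g r) = r := by
  simp [augmentation]

lemma single_sub_one_mem_Phi {N : Subgroup G} {g : G} (hg : g ∈ N) :
    (single g 1 - 1 : MonoidAlgebra R G) ∈ Phi R N := by
  have h : (single (⟨g, hg⟩ : N) 1 - 1 : MonoidAlgebra R N) ∈ augmentationIdeal R N := by
    simp [augmentationIdeal, RingHom.mem_ker, augmentation_single]
  have h' := Ideal.mem_map_of_mem (mapDomainAlgHom R R N.subtype) h
  rw [map_sub, map_one] at h'
  simpa [Phi] using h'

/-- To show that `Φ(N)` lies in an ideal, it suffices to consider the elements `g - 1`. -/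
lemma Phi_le {N : Subgroup G} {J : Ideal (MonoidAlgebra R G)}
    (h : ∀ g ∈ N, (single g 1 - 1 : MonoidAlgebra R G) ∈ J) : Phi R N ≤ J := by
  rw [Phi, Ideal.map_le_iff_le_comap]
  intro x hx
  have key : ∀ y : MonoidAlgebra R N,
      mapDomainAlgHom R R N.subtype y - single 1 (augmentation R N y) ∈ J := by
    intro y
    induction y using MonoidAlgebra.induction_linear with
    | zero => simp
    | add y z hy hz =>
      have := J.add_mem hy hz
      rwa [map_add, map_add, single_add, add_sub_add_comm]
    | single n r =>
      have := J.mul_mem_left (single 1 r) (h n n.2)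
      simpa [augmentation_single, mul_sub, single_mul_single] using this
  have := key x
  rw [show augmentation R N x = 0 from hx] at this
  simpa using this

lemma Phi_le_augmentationIdeal (N : Subgroup G) : Phi R N ≤ augmentationIdeal R G :=
  Phi_le fun g _ ↦ by simp [augmentationIdeal, RingHom.mem_ker, augmentation_single]

/-- Modulo `Φ(N)` each `g` is congruent to the chosen representative of its coset, so `x` is
congruent to a lift of its image. -/
lemma ker_mapDomainRingHom_mk (N : Subgroup G) :
    RingHom.ker (mapDomainRingHom R (QuotientGroup.mk' N)) = Phi R N := by
  apply le_antisymm
  · intro x hx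
    have key : ∀ y : MonoidAlgebra R G,
        y - mapDomain Quotient.out (mapDomain (QuotientGroup.mk' N) y) ∈ Phi R N := by
      intro y
      induction y using MonoidAlgebra.induction_linear with
      | zero => simp
      | add y z hy hz =>
        have := (Phi R N).add_mem hy hz
        rwa [mapDomain_add, mapDomain_add, add_sub_add_comm]
      | single g r =>
        obtain ⟨n, hn⟩ := QuotientGroup.mk_out_eq_mul N g
        have := (Phi R N).mul_mem_left (single g r) (single_sub_one_mem_Phi n.2)
        rw [← neg_mem_iff]
        simpa [mul_sub, single_mul_single, ← hn] using this
    have := key x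
    rw [show mapDomain (QuotientGroup.mk' N) x = 0 from hx] at this
    simpa using this
  · refine Phi_le fun g hg ↦ ?_
    have : QuotientGroup.mk' N g = 1 := (QuotientGroup.eq_one_iff g).mpr hg
    rw [RingHom.mem_ker, map_sub, map_one, mapDomainRingHom_apply, mapDomain_single, this,
      one_def, sub_self]

lemma isIntegral_of_isMulTorsion (hG : IsMulTorsion G) :
    Algebra.IsIntegral R (MonoidAlgebra R G) where
  isIntegral x := by
    induction x using MonoidAlgebra.induction_linear with
    | zero => exact isIntegral_zero
    | add y z hy hz => exact hy.add hz
    | single g r =>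
      obtain ⟨n, hn, h⟩ := (isOfFinOrder_iff_pow_eq_one).mp (hG g)
      refine IsIntegral.of_pow hn ?_
      rw [single_pow, h]
      exact isIntegral_algebraMap (A := MonoidAlgebra R G) (x := r ^ n)

/-- Maximal ideals contract to maximal ideals along an integral extension. -/
lemma jacobson_le_comap_of_isIntegral {A B : Type*} [CommRing A] [CommRing B] [Algebra A B]
    [Algebra.IsIntegral A B] :
    Ring.jacobson A ≤ (Ring.jacobson B).comap (algebraMap A B) := by
  intro x hx
  rw [Ideal.mem_comap, Ring.jacobson_eq_sInf_isMaximal, Ideal.mem_sInf]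
  intro M hM
  have : M.IsMaximal := hM
  have := Ideal.isMaximal_comap_of_isIntegral_of_isMaximal (R := A) M
  exact Ring.jacobson_le_of_isMaximal (M.comap (algebraMap A B)) hx

lemma isUnit_one_sub_of_mem_jacobson {A : Type*} [CommRing A] {x : A} (hx : x ∈ Ring.jacobson A) :
    IsUnit (1 - x) := by
  rw [← Ideal.jacobson_bot] at hx
  simpa [sub_eq_neg_add] using Ideal.mem_jacobson_bot.mp hx (-1)

lemma mem_jacobson_of_isUnit {A : Type*} [CommRing A] {x : A} (hx : ∀ r, IsUnit (1 - r * x)) :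
    x ∈ Ring.jacobson A := by
  rw [← Ideal.jacobson_bot, Ideal.mem_jacobson_bot]
  intro y
  convert hx (-y) using 1
  ring

/-- If `g` has prime order `p` and `g - 1` lies in the Jacobson radical of `RG`, then `p` lies in
the Jacobson radical of `R`. -/
lemma natCast_mem_jacobson {g : G} {p : ℕ} (hp : p.Prime) (hg : orderOf g = p)
    (h : (single g 1 - 1 : MonoidAlgebra R G) ∈ Ring.jacobson (MonoidAlgebra R G)) :
    (p : R) ∈ Ring.jacobson R := by
  classical
  set a : MonoidAlgebra R G := single g 1 with ha
  have hap : a ^ p = 1 := by rw [ha, single_pow, ← hg, pow_orderOf_eq_one, one_pow, one_def]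
  set e : MonoidAlgebra R G := ∑ i ∈ Finset.range p, a ^ i with he
  have hae : (a - 1) * e = 0 := by rw [he, mul_geom_sum, hap, sub_self]
  have hpow (i : ℕ) : a ^ i * e = e := by
    obtain ⟨c, hc⟩ := sub_one_dvd_pow_sub_one a i
    rw [← sub_eq_zero, ← sub_one_mul, hc, mul_right_comm, hae, zero_mul]
  have hee : e * e = p * e := by
    conv_lhs => enter [1]; rw [he]
    rw [Finset.sum_mul, Finset.sum_congr rfl fun i _ ↦ hpow i]
    simp
  -- As `e * e = p * e`, also `u * u = p * u`; and `u` is a sum of terms `1 - a ^ i`, hence in the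
  -- radical.
  set u : MonoidAlgebra R G := p - e with hu
  have huu : u * u = p * u := by rw [hu]; linear_combination hee
  have huJ : u ∈ Ring.jacobson (MonoidAlgebra R G) := by
    have : u = -∑ i ∈ Finset.range p, (a ^ i - 1) := by simp [hu, he]
    rw [this]
    refine neg_mem (sum_mem fun i _ ↦ ?_)
    obtain ⟨c, hc⟩ := sub_one_dvd_pow_sub_one a i
    rw [hc]
    exact Ideal.mul_mem_right _ _ h
  have hcoeff : u.coeff g = -1 := by
    have h1 : g ≠ 1 := by
      rintro rfl
      exact hp.one_lt.ne (by simpa using hg)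
    have h2 : ∀ i ∈ Finset.range p, (a ^ i).coeff g = if i = 1 then 1 else 0 := by
      intro i hi
      rw [ha, single_pow, one_pow, coeff_single, Finsupp.single_apply]
      refine if_congr ⟨fun hig ↦ ?_, fun h ↦ by simp [h]⟩ rfl rfl
      refine pow_injOn_Iio_orderOf (x := g) ?_ ?_ (by simpa using hig)
      · simpa [hg] using hi
      · simpa [hg] using hp.one_lt
    rw [hu, coeff_sub, Finsupp.sub_apply, he, coeff_sum, Finsupp.finsetSum_apply,
      Finset.sum_congr rfl h2, coeff_natCast, Finsupp.single_eq_of_ne h1]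
    simp [hp.one_lt]
  refine mem_jacobson_of_isUnit fun r ↦ ?_
  obtain ⟨v, hv⟩ := (isUnit_one_sub_of_mem_jacobson
    (Ideal.mul_mem_left _ (single 1 r) huJ)).exists_left_inv
  -- `u * u = p * u` gives `(1 - r * p) * u = (1 - r * u) * u`, and `v` inverts `1 - r * u`. The
  -- coefficient `-1` of `u` at `g` then makes `1 - r * p` a unit.
  have h3 : single 1 (1 - r * (p : R)) * (v * u) = u := by
    have : (single 1 (1 - r * (p : R)) : MonoidAlgebra R G) =
        1 - single 1 r * (p : MonoidAlgebra R G) := by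
      rw [single_sub, ← one_def, natCast_def p, single_mul_single, one_mul]
    rw [this]
    linear_combination u * hv + v * single 1 r * huu
  have h4 := congr_arg (fun x ↦ x.coeff g) h3
  simp only [coeff_single_one_mul, hcoeff] at h4
  exact IsUnit.of_mul_eq_one (-(v * u).coeff g) (by rw [mul_neg, h4, neg_neg])

/-- An element lives over the finite subgroup `K` generated by its support. By Cauchy `p` does not
divide `|K|`, so Maschke makes `kK` semisimple, hence reduced. -/
lemma isReduced_of_isMulTorsion {k : Type*} [Field k] {p : ℕ} [hp : Fact p.Prime] [CharP k p]
    (hH : IsMulTorsion H) (hpH : ∀ g : H, g ^ p = 1 → g = 1) :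
    IsReduced (MonoidAlgebra k H) where
  eq_zero x hx := by
    let K := Subgroup.closure (x.coeff.support : Set H)
    have : Finite K := CommGroup.finite_of_fg_isMulTorsion K (hH.subgroup K)
    have : NeZero (Nat.card K : k) := ⟨fun h ↦ by
      obtain ⟨g, hg⟩ := exists_prime_orderOf_dvd_card' p ((CharP.cast_eq_zero_iff k p _).mp h)
      have h1 : (g : H) = 1 := hpH g (by
        rw [← Subgroup.coe_pow, ← hg, pow_orderOf_eq_one, Subgroup.coe_one])
      rw [OneMemClass.coe_eq_one] at h1
      exact hp.out.one_lt.ne (by simpa [h1] using hg)⟩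
    obtain ⟨y, hyx⟩ : ∃ y, mapDomainRingHom k K.subtype y = x := by
      refine ⟨ofCoeff (x.coeff.comapDomain K.subtype K.subtype_injective.injOn), ?_⟩
      apply coeff_injective
      refine Finsupp.mapDomain_comapDomain _ K.subtype_injective _ fun g hg ↦ ?_
      exact ⟨⟨g, Subgroup.subset_closure hg⟩, rfl⟩
    have hy := (IsNilpotent.map_iff (f := mapDomainRingHom k K.subtype)
      (mapDomain_injective K.subtype_injective)).mp (hyx ▸ hx)
    rw [← hyx, hy.eq_zero, map_zero]

/-- For each maximal ideal `m` of `R`, `(R/m)H` is reduced, and is a Jacobson ring since it is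
integral over a field; so its radical is zero. Coefficients of a radical element thus lie in every
`m`, that is, in `𝔍(R) = 0`. -/
lemma jacobson_eq_bot_of_isMulTorsion {p : ℕ} [hp : Fact p.Prime] [CharP R p]
    (hR : Ring.jacobson R = ⊥) (hH : IsMulTorsion H) (hpH : ∀ g : H, g ^ p = 1 → g = 1) :
    Ring.jacobson (MonoidAlgebra R H) = ⊥ := by
  refine eq_bot_iff.mpr fun x hx ↦ ?_
  rw [Ideal.mem_bot]
  ext h
  rw [coeff_zero, Finsupp.zero_apply, ← Ideal.mem_bot, ← hR, Ring.jacobson_eq_sInf_isMaximal,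
    Ideal.mem_sInf]
  intro m hm
  have : m.IsMaximal := hm
  let := Ideal.Quotient.field m
  have : CharP (R ⧸ m) p := by
    rw [CharP.charP_iff_prime_eq_zero hp.out, ← map_natCast (Ideal.Quotient.mk m),
      CharP.cast_eq_zero, map_zero]
  have := isReduced_of_isMulTorsion (k := R ⧸ m) hH hpH
  have := isIntegral_of_isMulTorsion (R := R ⧸ m) hH
  have : IsJacobsonRing (MonoidAlgebra (R ⧸ m) H) := isJacobsonRing_of_isIntegral (R := R ⧸ m)
  have hsurj : Function.Surjective (mapRingHom H (Ideal.Quotient.mk m)) :=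
    map_surjective _ Ideal.Quotient.mk_surjective
  have h0 : mapRingHom H (Ideal.Quotient.mk m) x ∈ Ring.jacobson (MonoidAlgebra (R ⧸ m) H) := by
    have : RingHomSurjective (mapRingHom H (Ideal.Quotient.mk m)) := ⟨hsurj⟩
    exact Ring.le_comap_jacobson (mapRingHom H (Ideal.Quotient.mk m)) hx
  rw [← Ideal.jacobson_bot, ← Ideal.radical_eq_jacobson] at h0
  replace h0 := IsNilpotent.eq_zero (mem_nilradical.mp h0)
  rw [← Ideal.Quotient.eq_zero_iff_mem, ← coeff_mapRingHom, h0, coeff_zero,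
    Finsupp.zero_apply]

lemma jacobson_eq_Phi_primaryComponent (hG : IsMulTorsion G) {p : ℕ} [hp : Fact p.Prime]
    [CharP R p] (hR : Ring.jacobson R = ⊥) :
    Ring.jacobson (MonoidAlgebra R G) = Phi R (CommGroup.primaryComponent G p) := by
  set N := CommGroup.primaryComponent G p
  apply le_antisymm
  · have hsurj : Function.Surjective (mapDomainRingHom R (QuotientGroup.mk' N)) :=
      coeffEquiv.symm.surjective.comp <|
        (Finsupp.mapDomain_surjective (QuotientGroup.mk'_surjective N)).comp coeffEquiv.surjective
    have : RingHomSurjective (mapDomainRingHom R (QuotientGroup.mk' N)) := ⟨hsurj⟩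
    rw [← ker_mapDomainRingHom_mk, RingHom.ker_eq_comap_bot,
      ← jacobson_eq_bot_of_isMulTorsion (p := p) hR
        (hG.of_surjective (QuotientGroup.mk'_surjective N))]
    · exact Ring.le_comap_jacobson _
    -- `G/G_p` has no `p`-torsion: if `g ^ p ∈ G_p` then `g ∈ G_p`.
    · intro g hg
      obtain ⟨g, rfl⟩ := QuotientGroup.mk_surjective g
      rw [← QuotientGroup.mk_pow, QuotientGroup.eq_one_iff] at hg
      obtain ⟨k, hk⟩ := CommGroup.mem_primaryComponent.mp hg
      rw [QuotientGroup.eq_one_iff]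
      exact CommGroup.mem_primaryComponent.mpr ⟨k + 1, by rw [pow_succ', pow_mul, hk]⟩
  · refine Phi_le fun g hg ↦ nilradical_le_jacobson _ ?_
    obtain ⟨k, hk⟩ := CommGroup.mem_primaryComponent.mp hg
    have : CharP (MonoidAlgebra R G) p :=
      charP_of_injective_algebraMap (FaithfulSMul.algebraMap_injective R _) p
    -- Frobenius: `(g - 1) ^ (p ^ k) = g ^ (p ^ k) - 1 = 0`.
    exact ⟨p ^ k, by rw [sub_pow_char_pow, single_pow, hk, one_pow, one_pow, one_def, sub_self]; exact zero_mem _⟩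

end GroupRingIdeals

theorem proposition2p3 {R G : Type*} [CommRing R] [Nontrivial R] [CommGroup G]
    (hG : IsMulTorsion G) :
    ((∃ N : Subgroup G, N ≠ ⊥ ∧ Ring.jacobson (MonoidAlgebra R G) = GroupRingIdeals.Phi R N) ↔
      (Ring.jacobson R = ⊥ ∧ ∃ p ∈ GroupRingIdeals.supp G, CharP R p)) ∧
    (Ring.jacobson R = ⊥ → ∀ p ∈ GroupRingIdeals.supp G, CharP R p →
      Ring.jacobson (MonoidAlgebra R G) =
        GroupRingIdeals.Phi R (CommGroup.primaryComponent G p)) := by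
  have key : Ring.jacobson R = ⊥ → ∀ p ∈ GroupRingIdeals.supp G, CharP R p →
      Ring.jacobson (MonoidAlgebra R G) =
        GroupRingIdeals.Phi R (CommGroup.primaryComponent G p) := fun hR p hp _ ↦
    have : Fact p.Prime := ⟨hp.1⟩
    GroupRingIdeals.jacobson_eq_Phi_primaryComponent hG hR
  refine ⟨⟨fun ⟨N, hN, hJ⟩ ↦ ?_, fun ⟨hR, p, hp, hchar⟩ ↦ ⟨_, hp.2, key hR p hp hchar⟩⟩, key⟩
  have hR : Ring.jacobson R = ⊥ := by
    have := GroupRingIdeals.isIntegral_of_isMulTorsion (R := R) hG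
    refine eq_bot_iff.mpr fun r hr ↦ ?_
    have h := GroupRingIdeals.jacobson_le_comap_of_isIntegral (B := MonoidAlgebra R G) hr
    rw [Ideal.mem_comap, hJ] at h
    have h' : GroupRingIdeals.augmentation R G (algebraMap R _ r) = 0 :=
      GroupRingIdeals.Phi_le_augmentationIdeal N h
    simpa [GroupRingIdeals.augmentation_single] using h'
  obtain ⟨x, hxN, hx1⟩ := N.bot_or_exists_ne_one.resolve_left hN
  obtain ⟨p, hp, hpx⟩ := Nat.exists_prime_and_dvd (mt orderOf_eq_one_iff.mp hx1)
  -- A suitable power of `x` has order exactly `p` and stays in `N`.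
  have hg := orderOf_pow_orderOf_div (hG x).orderOf_pos.ne' hpx
  set g := x ^ (orderOf x / p)
  refine ⟨hR, p, ⟨hp, fun h ↦ ?_⟩, (CharP.charP_iff_prime_eq_zero hp).mpr ?_⟩
  · have : g ∈ CommGroup.primaryComponent G p :=
      CommGroup.mem_primaryComponent.mpr ⟨1, by rw [pow_one, ← hg, pow_orderOf_eq_one]⟩
    rw [h, Subgroup.mem_bot] at this
    exact hp.one_lt.ne (by simpa [this] using hg)
  · rw [← Ideal.mem_bot, ← hR]
    refine GroupRingIdeals.natCast_mem_jacobson hp hg ?_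
    rw [hJ]
    exact GroupRingIdeals.single_sub_one_mem_Phi (pow_mem hxN _)
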